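/- Let $\omega_1,\omega_2\in\mathbb C$ be linearly independent over $\mathbb R$, let $L=\mathbb Z\omega_1+\mathbb Z\omega_2$ be the lattice they generate, and let $$\wp(z)=\frac1{z^2}+\sum_{\omega\in L,\ \omega\neq 0}\left(\frac1{(z-\omega)^2}-\frac1{\omega^2}\right)$$ be its Weierstrass function. For a positive integer $m$, let $$DIV(m)=\{u\in\mathcal P \mid m u\in L,\ u\notin L\},\qquad \mathcal P=\{a\omega_1+b\omega_2 \mid a,b\in\mathbb R,\ 0\le a,b<1\},$$ be the set of $m$-division points in the fundamental parallelogram. Then, for every positive integer $m$, the set $DIV(m)$ is finite with exactly $m^2-1$ elements, and $$\sum_{u\in DIV(m)}\wp(u)=0.$$ -/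

import Mathlib

namespace PeriodPair

/-- The half-open fundamental parallelogram `{a ω₁ + b ω₂ | 0 ≤ a, b < 1}`. -/
def fundamentalParallelogram (L : PeriodPair) : Set ℂ :=
  {z | ∃ a b : ℝ, 0 ≤ a ∧ a < 1 ∧ 0 ≤ b ∧ b < 1 ∧ z = (a : ℂ) * L.ω₁ + (b : ℂ) * L.ω₂}

/-- `u` is an `m`-division point of the lattice: `m u` lies in the lattice, but `u` does not. -/
def IsDivisionPoint (L : PeriodPair) (m : ℕ) (u : ℂ) : Prop :=
  (m : ℂ) * u ∈ L.lattice ∧ u ∉ L.lattice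

/-- The set of all `m`-division points in the fundamental parallelogram. -/
def divisionPoints (L : PeriodPair) (m : ℕ) : Set ℂ :=
  {u | u ∈ L.fundamentalParallelogram ∧ L.IsDivisionPoint m u}

end PeriodPair

namespace PeriodPair

variable (L : PeriodPair)

/-! Let `t_p` run over the `m²` torsion points `(a ω₁ + b ω₂) / m` and let `S = ∑ ℘(t_p)`. Splitting
the series of `℘(m z)` along the classes of `L` modulo `m L` gives `∑ ℘(z - t_p) = m² ℘(m z) + S`
(`sum_weierstrassP_sub_torsionPoint`). The mean of `℘` over a period along a line parallel to `ω₁`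
has the same value `C` for all such lines that miss the lattice (`AvoidsLattice.horizontalMean_eq`).
Averaging the relation over such a period gives `m² C = m² C + S`, so `S = 0`. -/

lemma ω₁_ne_zero : L.ω₁ ≠ 0 := by
  have := L.indep.ne_zero 0
  simpa using this

/-- Real coordinates with respect to the two periods are unique. -/
lemma real_coordinates_unique {a b c d : ℝ}
    (h : (a : ℂ) * L.ω₁ + b * L.ω₂ = c * L.ω₁ + d * L.ω₂) : a = c ∧ b = d := by
  have := LinearIndependent.pair_iff.mp L.indep (a - c) (b - d)
    (by simp; linear_combination h)
  exact ⟨sub_eq_zero.mp this.1, sub_eq_zero.mp this.2⟩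

lemma real_coordinates_mem_lattice {a b : ℝ} :
    (a : ℂ) * L.ω₁ + b * L.ω₂ ∈ L.lattice ↔ ∃ i j : ℤ, a = i ∧ b = j := by
  rw [mem_lattice]
  constructor
  · rintro ⟨i, j, h⟩
    obtain ⟨h₁, h₂⟩ := L.real_coordinates_unique (a := a) (b := b) (c := i) (d := j)
      (by push_cast; exact h.symm)
    exact ⟨i, j, h₁, h₂⟩
  · rintro ⟨i, j, rfl, rfl⟩
    exact ⟨i, j, by push_cast; rfl⟩

/-- The quotient of the two periods. -/
noncomputable def periodRatio : ℂ := L.ω₂ / L.ω₁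

lemma ω₁_mul_periodRatio : L.ω₁ * L.periodRatio = L.ω₂ :=
  mul_div_cancel₀ _ L.ω₁_ne_zero

lemma im_periodRatio_ne_zero : L.periodRatio.im ≠ 0 := by
  intro h
  have h' : ((L.periodRatio.re : ℝ) : ℂ) = L.periodRatio := Complex.ext (by simp) (by simp [h])
  have := L.real_coordinates_unique (a := L.periodRatio.re) (b := 0) (c := 0) (d := 1)
    (by rw [h', ← L.ω₁_mul_periodRatio]; push_cast; ring)
  norm_num at this

/-! ### Means of `℘` along lines parallel to `ω₁`, in the coordinate `w = z / ω₁` -/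

/-- The horizontal line through `w` contains no point of the lattice `ℤ + ℤ (ω₂ / ω₁)`. -/
def AvoidsLattice (w : ℂ) : Prop := ∀ k : ℤ, w.im ≠ k * L.periodRatio.im

lemma AvoidsLattice.ω₁_mul_notMem {L : PeriodPair} {w : ℂ} (hw : L.AvoidsLattice w) :
    L.ω₁ * w ∉ L.lattice := by
  rw [mem_lattice]
  rintro ⟨i, j, h⟩
  have h' : w = i + j * L.periodRatio := by
    apply mul_left_cancel₀ L.ω₁_ne_zero
    rw [← h, mul_add, mul_left_comm, L.ω₁_mul_periodRatio]; ring
  apply hw j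
  rw [h']; simp

lemma AvoidsLattice.ofReal_add {L : PeriodPair} {w : ℂ} (hw : L.AvoidsLattice w) (x : ℝ) :
    L.AvoidsLattice (x + w) := fun k ↦ by simpa using hw k

lemma AvoidsLattice.continuous_weierstrassP {L : PeriodPair} {w : ℂ} (hw : L.AvoidsLattice w) :
    Continuous fun x : ℝ ↦ L.weierstrassP (L.ω₁ * (x + w)) := by
  refine continuous_iff_continuousAt.mpr fun x ↦ ?_
  have h := (L.differentiableOn_weierstrassP.differentiableAt
    (L.isClosed_lattice.isOpen_compl.mem_nhds (hw.ofReal_add x).ω₁_mul_notMem)).continuousAt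
  exact ContinuousAt.comp (f := fun x : ℝ ↦ L.ω₁ * (x + w)) h (by fun_prop)

lemma periodic_weierstrassP_ω₁_mul (w : ℂ) :
    Function.Periodic (fun x : ℝ ↦ L.weierstrassP (L.ω₁ * (x + w))) 1 := fun x ↦ by
  have := L.weierstrassP_add_coe (L.ω₁ * (x + w)) ⟨L.ω₁, L.ω₁_mem_lattice⟩
  simp only at this ⊢
  rw [← this]; congr 1; push_cast; ring

/-- The mean of `℘` along the segment from `ω₁ w` to `ω₁ w + ω₁`. -/
noncomputable def horizontalMean (w : ℂ) : ℂ := ∫ x in (0 : ℝ)..1, L.weierstrassP (L.ω₁ * (x + w))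

lemma horizontalMean_ofReal_add (t : ℝ) (w : ℂ) :
    L.horizontalMean (t + w) = L.horizontalMean w := by
  have h := (L.periodic_weierstrassP_ω₁_mul w).intervalIntegral_add_eq t 0
  rw [zero_add, add_comm t 1] at h
  rw [horizontalMean, horizontalMean, ← h]
  have := intervalIntegral.integral_comp_add_right (a := 0) (b := 1)
    (fun x : ℝ ↦ L.weierstrassP (L.ω₁ * (x + w))) t
  rw [zero_add] at this
  rw [← this]
  refine intervalIntegral.integral_congr fun x _ ↦ ?_
  congr 1; push_cast; ring

lemma horizontalMean_eq_im (w : ℂ) : L.horizontalMean w = L.horizontalMean (w.im * Complex.I) := by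
  conv_lhs => rw [← Complex.re_add_im w, horizontalMean_ofReal_add]

lemma horizontalMean_add_int_mul_periodRatio (w : ℂ) (k : ℤ) :
    L.horizontalMean (w + k * L.periodRatio) = L.horizontalMean w := by
  refine intervalIntegral.integral_congr fun x _ ↦ ?_
  have := L.weierstrassP_add_coe (L.ω₁ * (x + w)) (k • ⟨L.ω₂, L.ω₂_mem_lattice⟩)
  rw [← this]; congr 1
  simp [← L.ω₁_mul_periodRatio]; ring

/-- Cauchy's theorem on a rectangle of width one: the integrals over the vertical sides cancel by
periodicity. -/
lemma horizontalMean_eq_of_uIcc {a b : ℝ}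
    (h : ∀ y ∈ Set.uIcc a b, L.AvoidsLattice (y * Complex.I)) :
    L.horizontalMean (a * Complex.I) = L.horizontalMean (b * Complex.I) := by
  have := Complex.integral_boundary_rect_eq_zero_of_differentiableOn
    (fun w ↦ L.weierstrassP (L.ω₁ * w)) (a * Complex.I) (1 + b * Complex.I) ?_
  · simp only [Complex.mul_re, Complex.ofReal_re, Complex.I_re, mul_zero, Complex.ofReal_im,
      Complex.I_im, mul_one, sub_self, Complex.add_re, Complex.one_re, add_zero, Complex.mul_im,
      Complex.add_im, Complex.one_im, zero_add, Complex.ofReal_one, Complex.ofReal_zero] at this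
    have h' : ∀ y : ℝ, L.weierstrassP (L.ω₁ * (1 + y * Complex.I)) =
        L.weierstrassP (L.ω₁ * (y * Complex.I)) := fun y ↦ by
      have := L.periodic_weierstrassP_ω₁_mul (y * Complex.I) 0
      simpa using this
    simp only [h', add_sub_cancel_right] at this
    exact sub_eq_zero.mp this
  · intro w hw
    rw [Complex.mem_reProdIm] at hw
    have hv := (h w.im (by simpa using hw.2)).ofReal_add w.re
    rw [Complex.re_add_im] at hv
    have := L.differentiableOn_weierstrassP.differentiableAt
      (L.isClosed_lattice.isOpen_compl.mem_nhds hv.ω₁_mul_notMem)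
    exact (DifferentiableAt.comp w this (by fun_prop)).differentiableWithinAt

/-- Off the lattice, the mean of `℘` along a period does not depend on the segment. -/
lemma AvoidsLattice.horizontalMean_eq {L : PeriodPair} {w : ℂ} (hw : L.AvoidsLattice w) :
    L.horizontalMean w = L.horizontalMean ((L.periodRatio.im / 2 : ℝ) * Complex.I) := by
  have hτ := L.im_periodRatio_ne_zero
  set t := L.periodRatio.im with ht
  set s := w.im / t with hs
  have hwim : w.im = s * t := by rw [hs]; field_simp
  have hpos : 0 < Int.fract s := by
    refine lt_of_le_of_ne (Int.fract_nonneg s) fun h ↦ hw ⌊s⌋ ?_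
    rw [hwim, ← ht, ← Int.self_sub_floor] at *
    congr 1; linarith
  -- A shift by a multiple of the period ratio moves the line into the open strip between two
  -- adjacent rows of lattice points. The midline of that strip serves as the common reference.
  rw [← L.horizontalMean_add_int_mul_periodRatio w (-⌊s⌋), horizontalMean_eq_im]
  have him : (w + ((-⌊s⌋ : ℤ) : ℂ) * L.periodRatio).im = Int.fract s * t := by
    rw [← Int.self_sub_floor, sub_mul, ← hwim]
    simp [ht]; ring
  rw [him]
  apply horizontalMean_eq_of_uIcc
  intro y hy k hk
  simp only [Complex.mul_im, Complex.ofReal_re, Complex.I_im, mul_one, Complex.ofReal_im,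
    Complex.I_re, mul_zero, add_zero] at hk
  have hk' : (k : ℝ) ∈ Set.uIcc (Int.fract s) (1 / 2) := by
    rw [Set.mem_uIcc] at hy ⊢
    rw [hk, ← ht] at hy
    rcases lt_or_gt_of_ne hτ with h | h
    · rcases hy with hy | hy
      · right; constructor <;> nlinarith
      · left; constructor <;> nlinarith
    · rcases hy with hy | hy
      · left; constructor <;> nlinarith
      · right; constructor <;> nlinarith
  have hlt := Int.fract_lt_one s
  have h0 : (0 : ℝ) < k := lt_of_lt_of_le (lt_min hpos (by norm_num)) hk'.1
  have h1 : (k : ℝ) < 1 := lt_of_le_of_lt hk'.2 (max_lt hlt (by norm_num))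
  norm_cast at h0 h1
  lia

/-! ### Torsion points and the distribution relation -/

/-- The point `(a ω₁ + b ω₂) / m`. -/
noncomputable def torsionPoint (m : ℕ) (p : Fin m × Fin m) : ℂ :=
  ((p.1 : ℕ) * L.ω₁ + (p.2 : ℕ) * L.ω₂) / m

lemma torsionPoint_eq (m : ℕ) (p : Fin m × Fin m) :
    L.torsionPoint m p = (((p.1 : ℕ) / m : ℝ) : ℂ) * L.ω₁ + (((p.2 : ℕ) / m : ℝ) : ℂ) * L.ω₂ := by
  rw [torsionPoint]; push_cast; ring

lemma torsionPoint_injective (m : ℕ) : Function.Injective (L.torsionPoint m) := by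
  intro p q h
  have hm : (m : ℝ) ≠ 0 := by have := p.1.pos; positivity
  rw [torsionPoint_eq, torsionPoint_eq] at h
  obtain ⟨h₁, h₂⟩ := L.real_coordinates_unique h
  rw [div_left_inj' hm] at h₁ h₂
  exact Prod.ext (Fin.ext (by exact_mod_cast h₁)) (Fin.ext (by exact_mod_cast h₂))

lemma torsionPoint_zero (m : ℕ) [NeZero m] : L.torsionPoint m 0 = 0 := by
  simp [torsionPoint]

lemma torsionPoint_mem_lattice {m : ℕ} [NeZero m] {p : Fin m × Fin m} :
    L.torsionPoint m p ∈ L.lattice ↔ p = 0 := by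
  have hm : (0 : ℝ) < m := by have := NeZero.pos m; positivity
  refine ⟨fun h ↦ ?_, fun h ↦ by simp [h, torsionPoint_zero]⟩
  rw [torsionPoint_eq, real_coordinates_mem_lattice] at h
  obtain ⟨i, j, hi, hj⟩ := h
  have key : ∀ (a : Fin m) (i : ℤ), ((a : ℕ) / m : ℝ) = i → a = 0 := by
    intro a i h
    have h0 : (0 : ℝ) ≤ i := h ▸ by positivity
    have h1 : (i : ℝ) < 1 := by rw [← h, div_lt_one hm]; exact_mod_cast a.2
    norm_cast at h0 h1
    obtain rfl : i = 0 := by lia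
    rw [div_eq_iff hm.ne'] at h
    apply Fin.ext
    simpa using h
  exact Prod.ext (key _ _ hi) (key _ _ hj)

lemma divisionPoints_eq_image (m : ℕ) [NeZero m] :
    L.divisionPoints m = L.torsionPoint m '' {0}ᶜ := by
  have hm : (0 : ℝ) < m := by have := NeZero.pos m; positivity
  have hmc : (m : ℂ) ≠ 0 := by exact_mod_cast hm.ne'
  ext u
  constructor
  · rintro ⟨⟨a, b, ha, ha', hb, hb', rfl⟩, h, h'⟩
    have e : (m : ℂ) * (a * L.ω₁ + b * L.ω₂) =
      ((m * a : ℝ) : ℂ) * L.ω₁ + ((m * b : ℝ) : ℂ) * L.ω₂ := by push_cast; ring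
    rw [e, real_coordinates_mem_lattice] at h
    obtain ⟨i, j, hi, hj⟩ := h
    have key : ∀ (a : ℝ) (i : ℤ), 0 ≤ a → a < 1 → m * a = i →
        ∃ k : Fin m, a = (k : ℕ) / m := by
      intro a i h0 h1 h
      have hi0 : (0 : ℝ) ≤ i := h ▸ by positivity
      have hi1 : (i : ℝ) < m := by nlinarith
      norm_cast at hi0
      lift i to ℕ using hi0
      norm_cast at hi1
      exact ⟨⟨i, hi1⟩, by rw [eq_div_iff hm.ne', mul_comm, h]; simp⟩
    obtain ⟨k, rfl⟩ := key a i ha ha' hi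
    obtain ⟨l, rfl⟩ := key b j hb hb' hj
    have e' := L.torsionPoint_eq m (k, l)
    refine ⟨(k, l), ?_, e'⟩
    rintro h0
    apply h'
    rw [← e', torsionPoint_mem_lattice]
    exact h0
  · rintro ⟨p, hp, rfl⟩
    refine ⟨⟨_, _, by positivity, ?_, by positivity, ?_, L.torsionPoint_eq m p⟩, ?_, ?_⟩
    · rw [div_lt_one hm]; exact_mod_cast p.1.2
    · rw [div_lt_one hm]; exact_mod_cast p.2.2
    · rw [torsionPoint, mul_div_cancel₀ _ hmc, mem_lattice]
      exact ⟨(p.1 : ℕ), (p.2 : ℕ), by push_cast; rfl⟩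
    · rw [torsionPoint_mem_lattice]; exact hp

/-- Division with remainder in the lattice. -/
lemma bijective_torsionPoint_add (m : ℕ) [NeZero m] :
    Function.Bijective fun q : (Fin m × Fin m) × L.lattice ↦
      (⟨m * (L.torsionPoint m q.1 + q.2), by
        have hmc : (m : ℂ) ≠ 0 := NeZero.ne _
        rw [mul_add, torsionPoint, mul_div_cancel₀ _ hmc, ← nsmul_eq_mul, ← nsmul_eq_mul,
          ← nsmul_eq_mul]
        exact add_mem (add_mem (nsmul_mem L.ω₁_mem_lattice _) (nsmul_mem L.ω₂_mem_lattice _))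
          (nsmul_mem q.2.2 _)⟩ : L.lattice) := by
  have hmc : (m : ℂ) ≠ 0 := NeZero.ne _
  have hm : (0 : ℤ) < m := by exact_mod_cast NeZero.pos m
  constructor
  · rintro ⟨p, l, hl⟩ ⟨q, l', hl'⟩ h
    simp only [Subtype.mk.injEq, mul_right_inj' hmc] at h
    obtain ⟨a, b, rfl⟩ := mem_lattice.mp hl
    obtain ⟨c, d, rfl⟩ := mem_lattice.mp hl'
    rw [torsionPoint, torsionPoint] at h
    field_simp at h
    obtain ⟨h₁, h₂⟩ := L.real_coordinates_unique (a := ((p.1 : ℕ) : ℝ) + m * a)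
      (b := ((p.2 : ℕ) : ℝ) + m * b) (c := ((q.1 : ℕ) : ℝ) + m * c)
      (d := ((q.2 : ℕ) : ℝ) + m * d) (by push_cast; linear_combination h)
    have key : ∀ (x y : Fin m) (a b : ℤ), (((x : ℕ) : ℝ) + m * a = ((y : ℕ) : ℝ) + m * b) →
        x = y := by
      intro x y a b h
      have h : ((x : ℕ) : ℤ) + m * a = ((y : ℕ) : ℤ) + m * b := by exact_mod_cast h
      have := congrArg (· % (m : ℤ)) h
      simp only [Int.add_mul_emod_self_left] at this
      rw [Int.emod_eq_of_lt (by positivity) (by exact_mod_cast x.2),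
        Int.emod_eq_of_lt (by positivity) (by exact_mod_cast y.2)] at this
      exact Fin.ext (by exact_mod_cast this)
    obtain rfl : p = q := Prod.ext (key _ _ _ _ h₁) (key _ _ _ _ h₂)
    have h' : (a : ℂ) * L.ω₁ + b * L.ω₂ = c * L.ω₁ + d * L.ω₂ :=
      mul_left_cancel₀ hmc (by linear_combination h)
    simp [h']
  · rintro ⟨l, hl⟩
    obtain ⟨a, b, rfl⟩ := mem_lattice.mp hl
    have key : ∀ a : ℤ, ∃ x : Fin m, (a : ℂ) = (x : ℕ) + m * (a / m : ℤ) := by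
      intro a
      have h0 := Int.emod_nonneg a hm.ne'
      have h1 := Int.emod_lt_of_pos a hm
      refine ⟨⟨(a % m).toNat, by lia⟩, ?_⟩
      have : a = ((a % m).toNat : ℤ) + m * (a / m) := by
        rw [Int.toNat_of_nonneg h0, Int.emod_add_mul_ediv]
      exact_mod_cast this
    obtain ⟨x, hx⟩ := key a
    obtain ⟨y, hy⟩ := key b
    refine ⟨⟨(x, y), ⟨_, mem_lattice.mpr ⟨a / m, b / m, rfl⟩⟩⟩, ?_⟩
    simp only [Subtype.mk.injEq, torsionPoint]
    rw [mul_add, mul_div_cancel₀ _ hmc]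
    linear_combination (-L.ω₁) * hx - L.ω₂ * hy

/-- Distribution relation for `℘`, with the constant left explicit. -/
lemma sum_weierstrassP_sub_torsionPoint (m : ℕ) [NeZero m] (z : ℂ) :
    ∑ p, L.weierstrassP (z - L.torsionPoint m p) =
      m ^ 2 * L.weierstrassP (m * z) + ∑ p, L.weierstrassP (L.torsionPoint m p) := by
  have hmc : (m : ℂ) ≠ 0 := NeZero.ne _
  have h := ((Equiv.ofBijective _ (L.bijective_torsionPoint_add m)).hasSum_iff).mpr
    ((L.hasSum_weierstrassP (m * z)).mul_left ((m : ℂ) ^ 2))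
  have h' := h.prod_fiberwise (g := fun p ↦ L.weierstrassP (z - L.torsionPoint m p) -
    L.weierstrassP (L.torsionPoint m p)) fun p ↦ by
      -- Evaluating at `-t_p` and using evenness makes the terms `1 / l ^ 2` of the two series
      -- cancel.
      have h₁ := (L.hasSum_weierstrassP (z - L.torsionPoint m p)).sub
        (L.hasSum_weierstrassP (-L.torsionPoint m p))
      rw [weierstrassP_neg] at h₁
      refine (congrArg (HasSum · _ _) (funext fun l ↦ ?_)).mpr h₁
      change (m : ℂ) ^ 2 * (1 / (m * z - m * (L.torsionPoint m p + l)) ^ 2 -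
        1 / (m * (L.torsionPoint m p + l)) ^ 2) = _
      rw [← mul_sub, ← sub_sub, ← neg_add', neg_sq, mul_pow, mul_pow, sub_sub_sub_cancel_right,
        mul_sub]
      simp only [one_div, mul_inv, mul_inv_cancel_left₀ (pow_ne_zero 2 hmc)]
  have := h'.unique (hasSum_fintype _)
  rw [this, Finset.sum_sub_distrib, sub_add_cancel]

/-- The index `p = 0` is included; it contributes the default value `℘(0) = 0`. -/
lemma sum_weierstrassP_torsionPoint (m : ℕ) [NeZero m] :
    ∑ p, L.weierstrassP (L.torsionPoint m p) = 0 := by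
  have hm : (m : ℝ) ≠ 0 := NeZero.ne _
  have hmc : (m : ℂ) ≠ 0 := NeZero.ne _
  have hτ := L.im_periodRatio_ne_zero
  -- In units of the height of the period ratio, `w - t_p / ω₁` has height `(1/2 - b) / m` and `m w`
  -- has height `1/2`. Neither is an integer, by parity, so all lines involved miss the lattice.
  set w : ℂ := ((L.periodRatio.im / (2 * m) : ℝ) : ℂ) * Complex.I with hw
  have hwim : w.im = L.periodRatio.im / (2 * m) := by
    rw [hw, Complex.im_ofReal_mul, Complex.I_im, mul_one]
  have hoff (p : Fin m × Fin m) : L.ω₁⁻¹ * L.torsionPoint m p =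
      (((p.1 : ℕ) / m : ℝ) : ℂ) + (((p.2 : ℕ) / m : ℝ) : ℂ) * L.periodRatio := by
    rw [torsionPoint_eq, periodRatio]
    field_simp [L.ω₁_ne_zero]
  have hav (p : Fin m × Fin m) : L.AvoidsLattice (w - L.ω₁⁻¹ * L.torsionPoint m p) := by
    intro k hk
    rw [hoff, Complex.sub_im, Complex.add_im, Complex.ofReal_im, hwim,
      Complex.im_ofReal_mul] at hk
    field_simp at hk
    have h : (1 : ℝ) = 2 * ((p.2 : ℕ) + m * k) :=
      mul_left_cancel₀ hτ (by linear_combination hk)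
    have h : (1 : ℤ) = 2 * ((p.2 : ℕ) + m * k) := by exact_mod_cast h
    lia
  have hav' : L.AvoidsLattice (m * w) := by
    intro k hk
    rw [← Complex.ofReal_natCast, Complex.im_ofReal_mul, hwim] at hk
    field_simp at hk
    have h : (1 : ℝ) = 2 * k := by linarith
    have h : (1 : ℤ) = 2 * k := by exact_mod_cast h
    lia
  -- Substituting `m x` for `x` turns one period into `m` periods, with a factor `1 / m`.
  have hmul : ∫ x in (0 : ℝ)..1, L.weierstrassP (m * (L.ω₁ * (x + w))) =
      L.horizontalMean (m * w) := by
    have h1 := intervalIntegral.integral_comp_mul_left (a := 0) (b := 1)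
      (fun x : ℝ ↦ L.weierstrassP (L.ω₁ * (x + m * w))) hm
    have h2 := (L.periodic_weierstrassP_ω₁_mul (m * w)).intervalIntegral_add_zsmul_eq m 0
      fun _ _ ↦ hav'.continuous_weierstrassP.intervalIntegrable _ _
    simp only [zero_add, mul_zero, mul_one, natCast_zsmul, nsmul_eq_mul] at h1 h2
    rw [h2] at h1
    rw [horizontalMean, ← mul_right_inj' (one_ne_zero (α := ℂ)), one_mul, one_mul]
    convert h1 using 1
    · refine intervalIntegral.integral_congr fun x _ ↦ ?_
      congr 1; push_cast; ring
    · rw [Complex.real_smul]; push_cast; field_simp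
  have hint : ∫ x in (0 : ℝ)..1, ∑ p, L.weierstrassP (L.ω₁ * (x + w) - L.torsionPoint m p) =
      ∑ p, L.horizontalMean (w - L.ω₁⁻¹ * L.torsionPoint m p) := by
    have e (x : ℝ) (p : Fin m × Fin m) : L.ω₁ * (x + w) - L.torsionPoint m p =
        L.ω₁ * (x + (w - L.ω₁⁻¹ * L.torsionPoint m p)) := by
      rw [← add_sub_assoc, mul_sub, mul_inv_cancel_left₀ L.ω₁_ne_zero]
    simp_rw [e]
    rw [intervalIntegral.integral_finsetSum fun p _ ↦
      (hav p).continuous_weierstrassP.intervalIntegrable _ _]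
    rfl
  have hcont : Continuous fun x : ℝ ↦ L.weierstrassP (m * (L.ω₁ * (x + w))) := by
    have := hav'.continuous_weierstrassP.comp (continuous_const_mul (m : ℝ))
    refine this.congr fun x ↦ ?_
    simp only [Function.comp]; congr 1; push_cast; ring
  simp_rw [sum_weierstrassP_sub_torsionPoint] at hint
  rw [intervalIntegral.integral_add ((hcont.const_mul _).intervalIntegrable _ _)
    (continuous_const.intervalIntegrable _ _), intervalIntegral.integral_const_mul, hmul,
    hav'.horizontalMean_eq, Finset.sum_congr rfl fun p _ ↦ (hav p).horizontalMean_eq] at hint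
  simp at hint
  linear_combination hint

end PeriodPair

theorem mainTheorem12 (L : PeriodPair) (m : ℕ) (hm : 0 < m) :
    (L.divisionPoints m).Finite ∧
    (L.divisionPoints m).ncard = m ^ 2 - 1 ∧
    ∑ᶠ u ∈ L.divisionPoints m, L.weierstrassP u = 0 := by
  have : NeZero m := ⟨hm.ne'⟩
  rw [L.divisionPoints_eq_image m]
  refine ⟨Set.toFinite _, ?_, ?_⟩
  · rw [Set.ncard_image_of_injective _ (L.torsionPoint_injective m), Set.ncard_compl]
    simp [sq]
  · rw [finsum_mem_image (L.torsionPoint_injective m).injOn]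
    have h := L.sum_weierstrassP_torsionPoint m
    rw [Fintype.sum_eq_add_sum_compl 0, L.torsionPoint_zero, L.weierstrassP_zero, zero_add] at h
    rw [← h, ← finsum_mem_coe_finset]
    simp
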